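/- For complex $q$ with $|q|<1$ put $$\theta_2(q)=\sum_{m\in\mathbb{Z}+\frac12}q^{m^2},\qquad \theta_3(q)=\sum_{m\in\mathbb{Z}}q^{m^2},\qquad \theta_4(q)=\sum_{m\in\mathbb{Z}}(-1)^mq^{m^2},\qquad E_2(q)=1-24\sum_{n\ge1}\sigma_1(n)q^n,$$ where $\sigma_1(n)=\sum_{d\mid n}d$ and, in $\theta_2$, $q^{m^2}$ is taken with the principal branch (only $\theta_2^4$ is used below, and it does not depend on the branch). Put $$\Theta_{r,s}(q)=\theta_2(q)^{4r}\theta_3(q)^{4s}+\theta_2(q)^{4s}\theta_3(q)^{4r}\quad(r,s\ge0),\qquad D=q\frac{d}{dq}.$$ Define rational numbers $c_c(\alpha,\beta,\gamma)$ for integers $\alpha,\beta,\gamma$ by $c_c(\alpha,\beta,\gamma)=0$ if any argument is negative, $c_c(0,0,0)=1$, and, for all other $\alpha,\beta,\gamma\ge0$, $$\begin{aligned} c_c(\alpha,\beta,\gamma)&=\tfrac{2\alpha+4\beta+4\gamma-1}{24}\,c_c(\alpha-1,\beta,\gamma)+\tfrac{20\gamma-4\beta+3}{24}\,c_c(\alpha,\beta-1,\gamma)+\tfrac{20\beta-4\gamma+3}{24}\,c_c(\alpha,\beta,\gamma-1)\\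 &\quad-\tfrac{7(\alpha+1)}{6}\,c_c(\alpha+1,\beta-1,\gamma-1)-\tfrac{\alpha+1}{12}\,c_c(\alpha+1,\beta-2,\gamma)-\tfrac{\alpha+1}{12}\,c_c(\alpha+1,\beta,\gamma-2). \end{aligned}$$ Then for every integer $t\ge1$ and every complex $q$ with $|q|<1$ one has $\theta_4(q)\ne0$ and $$\frac{(D^t\theta_4)(q)}{\theta_4(q)}=\frac12\sum_{\substack{\alpha,\beta,\gamma\ge0\\ \alpha+\beta+\gamma=t}}c_c(\alpha,\beta,\gamma)\,E_2(q)^{\alpha}\,\Theta_{\beta,\gamma}(q).$$ -/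

import Mathlib

noncomputable section

namespace QTheta

/-- The Eisenstein series `E_{2k}(q) = 1 - (4k / B_{2k}) ∑_{n ≥ 1} σ_{2k-1}(n) q^n`. -/
def eisenstein (k : ℕ) (q : ℂ) : ℂ :=
  1 - (4 * (k : ℂ) / ((bernoulli (2 * k) : ℚ) : ℂ)) *
    ∑' n : ℕ+, (ArithmeticFunction.sigma (2 * k - 1) (n : ℕ) : ℂ) * q ^ (n : ℕ)

/-- `θ₂(q) = ∑_{m ∈ ℤ + 1/2} q^{m²}`, with the principal branch of the complex power;
every branch gives the same value of `θ₂(q)^4`. -/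
def theta2 (q : ℂ) : ℂ := ∑' m : ℤ, q ^ (((m : ℂ) + 1 / 2) ^ 2)

/-- `θ₃(q) = ∑_{m ∈ ℤ} q^{m²}`. -/
def theta3 (q : ℂ) : ℂ := ∑' m : ℤ, q ^ (m ^ 2)

/-- `θ₄(q) = ∑_{m ∈ ℤ} (-1)^m q^{m²}`. -/
def theta4 (q : ℂ) : ℂ := ∑' m : ℤ, (-1 : ℂ) ^ m * q ^ (m ^ 2)

/-- `Θ_{r,s}(q) = θ₂^{4r} θ₃^{4s} + θ₂^{4s} θ₃^{4r}`. -/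
def Theta (r s : ℕ) (q : ℂ) : ℂ :=
  theta2 q ^ (4 * r) * theta3 q ^ (4 * s) + theta2 q ^ (4 * s) * theta3 q ^ (4 * r)

/-- The operator `D = q d/dq`. -/
def D (f : ℂ → ℂ) : ℂ → ℂ := fun q => q * deriv f q

/-- The rational coefficients `c_c(α, β, γ)`: zero if an argument is negative, one at the origin,
and given by the six-term recursion otherwise. -/
def cc (α β γ : ℤ) : ℚ :=
  if α < 0 ∨ β < 0 ∨ γ < 0 then 0
  else if α = 0 ∧ β = 0 ∧ γ = 0 then 1
  else
    (2 * α + 4 * β + 4 * γ - 1) / 24 * cc (α - 1) β γ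
    + (20 * γ - 4 * β + 3) / 24 * cc α (β - 1) γ
    + (20 * β - 4 * γ + 3) / 24 * cc α β (γ - 1)
    - 7 * (α + 1) / 6 * cc (α + 1) (β - 1) (γ - 1)
    - (α + 1) / 12 * cc (α + 1) (β - 2) γ
    - (α + 1) / 12 * cc (α + 1) β (γ - 2)
termination_by (α + β + γ).toNat
decreasing_by all_goals omega

end QTheta

end

noncomputable section

namespace QTheta

open Filter Topology


/-! Write x = θ₂⁴, y = θ₃⁴, E = E₂. The functions θ₄, x, y, E satisfy a closed differential system:
D log θ₄ = (E - x - y)/24, D log x = (E + 5y - x)/6, D log y = (E + 5x - y)/6, and DE = (E² - x² -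
14xy - y²)/12. Hence D^t θ₄ is θ₄ times a homogeneous polynomial of degree t in E, x, y. The
recursion for `cc` is the transpose of one application of D to θ₄ E^α x^β y^γ
(`mon_shift_eq_monStep`), so `cc` gives the coefficients. It is symmetric in β and γ (`cc_symm`),
and averaging each monomial with its mirror image produces ½ Θ.

The system is proved without modular forms. Splitting ℤ² by parity gives quadratic transformations
relating theta values at q and q². The iterates q^(2^n) tend to 0, so a function continuous at 0 and
invariant under q ↦ q² is constant (`eq_value_zero_of_eq_sq`). If f(q) = 4 f(q²), f(0) = 0 and f is
differentiable at 0, then f = 0 (`eq_zero_of_eq_four_mul_sq`). The first principle yields the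
logarithmic derivatives of x/y and y/θ₄⁴; the second yields the equation for DE, with E replaced by
`thetaE`, which is defined so that the equation for θ₄ holds.

It remains to identify `thetaE` with E₂. Gauss's product for θ₄, the limit of a finite triple
product at z = -1, has logarithmic derivative 24 D log θ₄ = 2E₂(q) - 2E₂(q²). The function `thetaE`
satisfies the same relation, so the difference is invariant under q ↦ q² and vanishes at 0. -/

/-! ### Power series with exponents indexed by the integers -/

/-- The series `∑_{m ∈ ℤ} q ^ e(m)`. -/
def intPowSeries (e : ℤ → ℕ) (q : ℂ) : ℂ := ∑' m : ℤ, q ^ e m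

lemma summable_pow_natAbs {r : ℝ} (h0 : 0 ≤ r) (h1 : r < 1) :
    Summable fun m : ℤ => r ^ m.natAbs := by
  refine Summable.of_nat_of_neg ?_ ?_ <;> simpa using summable_geometric_of_lt_one h0 h1

/-- The slack `+ 1` in the hypothesis is forced by m² + m, which vanishes at m = -1; it costs the
factor `r⁻¹`. -/
lemma norm_pow_exponent_le {e : ℤ → ℕ} (he : ∀ m, m.natAbs ≤ e m + 1) {r : ℝ} (h0 : 0 < r)
    (h1 : r < 1) {q : ℂ} (hq : ‖q‖ ≤ r) (m : ℤ) : ‖q ^ e m‖ ≤ r⁻¹ * r ^ m.natAbs := by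
  rw [norm_pow]
  calc ‖q‖ ^ e m ≤ r ^ e m := pow_le_pow_left₀ (norm_nonneg _) hq _
    _ = r⁻¹ * r ^ (e m + 1) := by rw [pow_succ']; field_simp
    _ ≤ r⁻¹ * r ^ m.natAbs := by
      gcongr r⁻¹ * ?_
      exact pow_le_pow_of_le_one h0.le h1.le (he m)

lemma exists_norm_le_lt_one {q : ℂ} (hq : ‖q‖ < 1) : ∃ r : ℝ, 0 < r ∧ r < 1 ∧ ‖q‖ < r := by
  obtain ⟨r, h1, h2⟩ := exists_between hq
  exact ⟨r, (norm_nonneg q).trans_lt h1, h2, h1⟩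

lemma summable_norm_intPow {e : ℤ → ℕ} (he : ∀ m, m.natAbs ≤ e m + 1) {q : ℂ} (hq : ‖q‖ < 1) :
    Summable fun m : ℤ => ‖q ^ e m‖ := by
  obtain ⟨r, h0, h1, h⟩ := exists_norm_le_lt_one hq
  exact .of_nonneg_of_le (fun _ => norm_nonneg _) (norm_pow_exponent_le he h0 h1 h.le)
    ((summable_pow_natAbs h0.le h1).mul_left _)

lemma differentiableAt_intPowSeries {e : ℤ → ℕ} (he : ∀ m, m.natAbs ≤ e m + 1) {q : ℂ}
    (hq : ‖q‖ < 1) : DifferentiableAt ℂ (intPowSeries e) q := by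
  obtain ⟨r, h0, h1, h⟩ := exists_norm_le_lt_one hq
  have hd : DifferentiableOn ℂ (intPowSeries e) (Metric.ball 0 r) :=
    Complex.differentiableOn_tsum_of_summable_norm ((summable_pow_natAbs h0.le h1).mul_left r⁻¹)
      (fun m => by fun_prop) Metric.isOpen_ball fun m w hw =>
        norm_pow_exponent_le he h0 h1 (by simpa using (mem_ball_zero_iff.1 hw).le) m
  exact hd.differentiableAt (Metric.isOpen_ball.mem_nhds (by simpa using h))

/-! ### The theta series as integer-indexed power series -/

/-- The series `∑_{m ∈ ℤ} q ^ (m² + m)`, equal to `q ^ (-1/4) θ₂(q)`. -/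
def psi (q : ℂ) : ℂ := intPowSeries (fun m => (m ^ 2 + m).toNat) q

lemma toNat_sq_add_self (m : ℤ) : ((m ^ 2 + m).toNat : ℤ) = m ^ 2 + m :=
  Int.toNat_of_nonneg (by
    rcases le_or_gt 0 m with h | h
    · positivity
    · nlinarith)

lemma natAbs_le_psi_exponent (m : ℤ) : m.natAbs ≤ (m ^ 2 + m).toNat + 1 := by
  zify
  rw [toNat_sq_add_self]
  rcases le_or_gt 0 m with h | h
  · rw [abs_of_nonneg h]; nlinarith
  · rw [abs_of_neg h]; nlinarith [sq_nonneg (m + 1)]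

lemma natAbs_le_sq_exponent (m : ℤ) : m.natAbs ≤ m.natAbs ^ 2 + 1 := by nlinarith

lemma zpow_sq (q : ℂ) (m : ℤ) : q ^ (m ^ 2) = q ^ (m.natAbs ^ 2) := by
  rw [← zpow_natCast]; simp

lemma theta3_eq : theta3 = intPowSeries fun m => m.natAbs ^ 2 := by
  ext q
  simp only [theta3, intPowSeries, zpow_sq]

lemma neg_one_zpow_eq_natAbs_sq (m : ℤ) : (-1 : ℂ) ^ m = (-1) ^ (m.natAbs ^ 2) := by
  rcases Int.even_or_odd m with h | h
  · rw [h.neg_one_zpow, Even.neg_one_pow]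
    exact (Int.natAbs_even.2 h).pow_of_ne_zero two_ne_zero
  · rw [h.neg_one_zpow, Odd.neg_one_pow]
    exact (Int.natAbs_odd.2 h).pow

lemma theta4_eq (q : ℂ) : theta4 q = theta3 (-q) := by
  rw [theta3_eq]
  simp only [theta4, intPowSeries, zpow_sq]
  exact tsum_congr fun m => by rw [neg_pow q, neg_one_zpow_eq_natAbs_sq]

lemma differentiableAt_theta3 {q : ℂ} (hq : ‖q‖ < 1) : DifferentiableAt ℂ theta3 q := by
  rw [theta3_eq]; exact differentiableAt_intPowSeries natAbs_le_sq_exponent hq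

lemma differentiableAt_theta4 {q : ℂ} (hq : ‖q‖ < 1) : DifferentiableAt ℂ theta4 q := by
  rw [show theta4 = fun q => theta3 (-q) from funext theta4_eq]
  exact (differentiableAt_theta3 (by simpa using hq)).comp q differentiable_neg.differentiableAt

lemma differentiableAt_psi {q : ℂ} (hq : ‖q‖ < 1) : DifferentiableAt ℂ psi q :=
  differentiableAt_intPowSeries natAbs_le_psi_exponent hq

lemma theta3_zero : theta3 0 = 1 := by
  rw [theta3_eq, intPowSeries, tsum_eq_single 0]
  · simp
  · intro m hm; simp [hm]

lemma theta4_zero : theta4 0 = 1 := by rw [theta4_eq, neg_zero, theta3_zero]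

lemma psi_zero : psi 0 = 2 := by
  rw [psi, intPowSeries, tsum_eq_sum (s := {0, -1})]
  · norm_num
  · intro m hm
    simp only [Finset.mem_insert, Finset.mem_singleton, not_or] at hm
    refine zero_pow fun h => ?_
    have h' := toNat_sq_add_self m
    rw [h] at h'
    have : m * (m + 1) = 0 := by push_cast at h'; linarith
    rcases mul_eq_zero.1 this with h | h <;> omega

lemma theta2_eq (q : ℂ) : theta2 q = q ^ (1 / 4 : ℂ) * psi q := by
  rw [theta2, psi, intPowSeries, ← tsum_mul_left]
  refine tsum_congr fun m => ?_
  -- At q = 0 every exponent (m + 1/2)² is nonzero, so both sides are 0; elsewhere exponents add.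
  rcases eq_or_ne q 0 with rfl | hq
  · rw [Complex.zero_cpow, Complex.zero_cpow, zero_mul]
    · norm_num
    · have : (2 * m + 1 : ℤ) ≠ 0 := by omega
      have h : (2 * m + 1 : ℂ) ≠ 0 := by exact_mod_cast this
      refine pow_ne_zero 2 fun h0 => h ?_
      linear_combination 2 * h0
  · rw [← Complex.cpow_natCast q, ← Complex.cpow_add _ _ hq]
    congr 1
    have := congrArg (Int.cast : ℤ → ℂ) (toNat_sq_add_self m)
    push_cast at this
    rw [this]; ring

lemma theta2_pow_four (q : ℂ) : theta2 q ^ 4 = q * psi q ^ 4 := by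
  rw [theta2_eq, mul_pow, ← Complex.cpow_nat_mul]
  norm_num

/-! ### Quadratic transformations -/

/-- The splitting of `ℤ²` into pairs with even and with odd coordinate sum. -/
def paritySplit : (ℤ × ℤ) ⊕ (ℤ × ℤ) ≃ ℤ × ℤ :=
  Equiv.ofBijective
    (Sum.elim (fun v => (v.1 + v.2, v.1 - v.2)) (fun v => (v.1 + v.2 + 1, v.1 - v.2))) <| by
    constructor
    · rintro (⟨a, b⟩ | ⟨a, b⟩) (⟨c, d⟩ | ⟨c, d⟩) h <;>
        simp only [Sum.elim_inl, Sum.elim_inr, Prod.mk.injEq, Sum.inl.injEq, Sum.inr.injEq,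
          reduceCtorEq] at h ⊢ <;> omega
    · rintro ⟨m, n⟩
      rcases Int.even_or_odd' (m + n) with ⟨k, h | h⟩
      · exact ⟨Sum.inl (k, m - k), by simp only [Sum.elim_inl, Prod.mk.injEq]; omega⟩
      · exact ⟨Sum.inr (k, m - k - 1), by simp only [Sum.elim_inr, Prod.mk.injEq]; omega⟩

lemma tsum_parity_split {f : ℤ × ℤ → ℂ} (hf : Summable f) :
    ∑' v, f v = ∑' v : ℤ × ℤ, f (v.1 + v.2, v.1 - v.2) +
      ∑' v : ℤ × ℤ, f (v.1 + v.2 + 1, v.1 - v.2) := by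
  have hs : Summable (f ∘ paritySplit) := paritySplit.summable_iff.2 hf
  rw [← paritySplit.tsum_eq]
  exact (HasSum.sum (f := f ∘ paritySplit)
    (hs.comp_injective Sum.inl_injective).hasSum
    (hs.comp_injective Sum.inr_injective).hasSum).tsum_eq

lemma norm_sq_lt_one {q : ℂ} (hq : ‖q‖ < 1) : ‖q ^ 2‖ < 1 := by
  rw [norm_pow]; exact pow_lt_one₀ (norm_nonneg _) hq two_ne_zero

lemma intPowSeries_mul {e f : ℤ → ℕ} (he : ∀ m, m.natAbs ≤ e m + 1)
    (hf : ∀ m, m.natAbs ≤ f m + 1) {p q : ℂ} (hp : ‖p‖ < 1) (hq : ‖q‖ < 1) :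
    intPowSeries e p * intPowSeries f q = ∑' v : ℤ × ℤ, p ^ e v.1 * q ^ f v.2 :=
  tsum_mul_tsum_of_summable_norm (summable_norm_intPow he hp) (summable_norm_intPow hf hq)

lemma summable_intPow_mul {e f : ℤ → ℕ} (he : ∀ m, m.natAbs ≤ e m + 1)
    (hf : ∀ m, m.natAbs ≤ f m + 1) {p q : ℂ} (hp : ‖p‖ < 1) (hq : ‖q‖ < 1) :
    Summable fun v : ℤ × ℤ => p ^ e v.1 * q ^ f v.2 :=
  summable_mul_of_summable_norm (f := fun m => p ^ e m) (g := fun m => q ^ f m)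
    (summable_norm_intPow he hp) (summable_norm_intPow hf hq)

lemma theta3_sq {q : ℂ} (hq : ‖q‖ < 1) :
    theta3 q ^ 2 = theta3 (q ^ 2) ^ 2 + q * psi (q ^ 2) ^ 2 := by
  have hq2 := norm_sq_lt_one hq
  simp only [theta3_eq, psi, sq (intPowSeries _ _)]
  rw [intPowSeries_mul natAbs_le_sq_exponent natAbs_le_sq_exponent hq hq,
    intPowSeries_mul natAbs_le_sq_exponent natAbs_le_sq_exponent hq2 hq2,
    intPowSeries_mul natAbs_le_psi_exponent natAbs_le_psi_exponent hq2 hq2,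
    tsum_parity_split (summable_intPow_mul natAbs_le_sq_exponent natAbs_le_sq_exponent hq hq),
    ← tsum_mul_left]
  congr 1
  · refine tsum_congr fun v => ?_
    simp only [← pow_mul, ← pow_add]
    congr 1; zify; simp only [sq_abs]; ring
  · refine tsum_congr fun v => ?_
    simp only [← pow_mul, ← pow_add, ← pow_succ']
    congr 1; zify; simp only [sq_abs, toNat_sq_add_self]; ring

lemma theta4_sq {q : ℂ} (hq : ‖q‖ < 1) :
    theta4 q ^ 2 = theta3 (q ^ 2) ^ 2 - q * psi (q ^ 2) ^ 2 := by
  rw [theta4_eq, theta3_sq (by simpa using hq), neg_sq]; ring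

lemma psi_sq {q : ℂ} (hq : ‖q‖ < 1) : psi q ^ 2 = 2 * (psi (q ^ 2) * theta3 (q ^ 2)) := by
  have hq2 := norm_sq_lt_one hq
  have hprod := intPowSeries_mul natAbs_le_sq_exponent natAbs_le_psi_exponent hq2 hq2
  rw [two_mul]
  simp only [theta3_eq, psi, sq (intPowSeries _ _)]
  rw [intPowSeries_mul natAbs_le_psi_exponent natAbs_le_psi_exponent hq hq,
    tsum_parity_split (summable_intPow_mul natAbs_le_psi_exponent natAbs_le_psi_exponent hq hq)]
  congr 1
  · rw [intPowSeries_mul natAbs_le_psi_exponent natAbs_le_sq_exponent hq2 hq2]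
    refine tsum_congr fun v => ?_
    simp only [← pow_mul, ← pow_add]
    congr 1; zify; simp only [sq_abs, toNat_sq_add_self]; ring
  · rw [mul_comm (intPowSeries _ _), hprod]
    -- The odd class has exponent 2(a + 1)² + 2(b² + b), so it is the same product after a ↦ a + 1.
    conv_rhs => rw [← ((Equiv.addRight (1 : ℤ)).prodCongr (Equiv.refl ℤ)).tsum_eq]
    refine tsum_congr fun v => ?_
    simp only [← pow_mul, ← pow_add, Equiv.prodCongr_apply, Prod.map, Equiv.coe_addRight,
      Equiv.refl_apply]
    congr 1; zify; simp only [sq_abs, toNat_sq_add_self]; ring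

lemma theta3_mul_theta4 {q : ℂ} (hq : ‖q‖ < 1) : theta3 q * theta4 q = theta4 (q ^ 2) ^ 2 := by
  have hq2 := norm_sq_lt_one hq
  have hnq : ‖-q‖ < 1 := by simpa using hq
  have hnq2 : ‖-q ^ 2‖ < 1 := by simpa using hq2
  have hs := summable_intPow_mul natAbs_le_sq_exponent natAbs_le_sq_exponent hq hnq
  simp only [theta4_eq, theta3_eq, sq (intPowSeries _ _)]
  rw [intPowSeries_mul natAbs_le_sq_exponent natAbs_le_sq_exponent hq hnq,
    intPowSeries_mul natAbs_le_sq_exponent natAbs_le_sq_exponent hnq2 hnq2, tsum_parity_split hs]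
  simp only [neg_pow q, neg_pow (q ^ 2), ← neg_one_zpow_eq_natAbs_sq]
  rw [show ∑' v : ℤ × ℤ, q ^ ((v.1 + v.2 + 1).natAbs ^ 2) *
      ((-1) ^ (v.1 - v.2) * q ^ ((v.1 - v.2).natAbs ^ 2)) = 0 from ?_, add_zero]
  · refine tsum_congr fun v => ?_
    have h : q ^ ((v.1 + v.2).natAbs ^ 2) * q ^ ((v.1 - v.2).natAbs ^ 2) =
        (q ^ 2) ^ (v.1.natAbs ^ 2) * (q ^ 2) ^ (v.2.natAbs ^ 2) := by
      simp only [← pow_mul, ← pow_add]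
      congr 1; zify; simp only [sq_abs]; ring
    have h' : (-1 : ℂ) ^ (v.1 - v.2) = (-1) ^ v.1 * (-1) ^ v.2 := by
      rw [zpow_sub₀ (by norm_num), div_eq_mul_inv, ← zpow_neg, zpow_neg, ← inv_zpow]; norm_num
    rw [h']
    linear_combination (-1 : ℂ) ^ v.1 * (-1) ^ v.2 * h
  -- On the odd class, a ↦ -1 - a sends (m, n) to (-n, -m). It preserves m² + n² and flips the sign,
  -- as m + n is odd, so this sum is its own negative.
  · rw [← self_eq_neg, ← tsum_neg]
    conv_lhs => rw [← ((Equiv.subLeft (-1 : ℤ)).prodCongr (Equiv.refl ℤ)).tsum_eq]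
    refine tsum_congr fun v => ?_
    simp only [Equiv.prodCongr_apply, Prod.map, Equiv.subLeft_apply, Equiv.refl_apply]
    have h1 : (-1 : ℂ) ^ (-1 - v.1 - v.2) = -(-1) ^ (v.1 - v.2) := by
      rw [show -1 - v.1 - v.2 = (v.1 - v.2) + (-1 - 2 * v.1) by ring, zpow_add₀ (by norm_num),
        Odd.neg_one_zpow (n := -1 - 2 * v.1) ⟨-1 - v.1, by ring⟩]
      ring
    have h2 : -1 - v.1 + v.2 + 1 = -(v.1 - v.2) := by ring
    have h3 : -1 - v.1 - v.2 = -(v.1 + v.2 + 1) := by ring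
    rw [h1, h2, h3, Int.natAbs_neg, Int.natAbs_neg]
    ring

/-- Jacobi's identity `θ₃⁴ = θ₂⁴ + θ₄⁴`. -/
lemma theta3_pow_four {q : ℂ} (hq : ‖q‖ < 1) :
    theta3 q ^ 4 = q * psi q ^ 4 + theta4 q ^ 4 := by
  have h3 := theta3_sq hq
  have h4 := theta4_sq hq
  have h2 := psi_sq hq
  rw [show theta3 q ^ 4 = (theta3 q ^ 2) ^ 2 by ring,
    show theta4 q ^ 4 = (theta4 q ^ 2) ^ 2 by ring,
    show psi q ^ 4 = (psi q ^ 2) ^ 2 by ring, h3, h4, h2]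
  ring

/-! ### Iterating `q ↦ q²` -/

lemma norm_pow_two_pow_lt_one {q : ℂ} (hq : ‖q‖ < 1) (n : ℕ) : ‖q ^ 2 ^ n‖ < 1 := by
  rw [norm_pow]; exact pow_lt_one₀ (norm_nonneg _) hq (by positivity)

lemma tendsto_pow_two_pow {q : ℂ} (hq : ‖q‖ < 1) :
    Tendsto (fun n : ℕ => q ^ 2 ^ n) atTop (𝓝 0) :=
  (tendsto_pow_atTop_nhds_zero_of_norm_lt_one hq).comp
    (tendsto_pow_atTop_atTop_of_one_lt one_lt_two)

/-- A zero at q propagates along q^(2^n) → 0, and continuity would force f(0) = 0. -/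
lemma ne_zero_of_ne_zero_sq {f : ℂ → ℂ} (hc : ContinuousAt f 0) (h0 : f 0 ≠ 0)
    (hf : ∀ q, ‖q‖ < 1 → f q = 0 → f (q ^ 2) = 0) {q : ℂ} (hq : ‖q‖ < 1) : f q ≠ 0 := by
  intro h
  have hn : ∀ n : ℕ, f (q ^ 2 ^ n) = 0 := by
    intro n
    induction n with
    | zero => simpa using h
    | succ n ih =>
      rw [pow_succ, pow_mul]
      exact hf _ (norm_pow_two_pow_lt_one hq n) ih
  have := hc.tendsto.comp (tendsto_pow_two_pow hq)
  simp only [Function.comp_def, hn] at this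
  exact h0 (tendsto_nhds_unique this tendsto_const_nhds)

lemma eq_value_zero_of_eq_sq {f : ℂ → ℂ} (hc : ContinuousAt f 0)
    (hf : ∀ q, ‖q‖ < 1 → f q = f (q ^ 2)) {q : ℂ} (hq : ‖q‖ < 1) : f q = f 0 := by
  by_contra h
  refine ne_zero_of_ne_zero_sq (f := fun p => f p - f q) (hc.sub continuousAt_const)
    (sub_ne_zero.2 (Ne.symm h)) (fun p hp hpq => ?_) hq (sub_self _)
  rwa [← hf p hp]

/-- Iteration gives f(q) = 4^n f(q^(2^n)). Differentiability makes this O(4^n q^(2^n)), which tends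
to 0. Continuity alone would not do: (log |q|)⁻² satisfies the same equation for 0 < |q| < 1. -/
lemma eq_zero_of_eq_four_mul_sq {f : ℂ → ℂ} (hd : DifferentiableAt ℂ f 0) (h0 : f 0 = 0)
    (hf : ∀ q, ‖q‖ < 1 → f q = 4 * f (q ^ 2)) {q : ℂ} (hq : ‖q‖ < 1) : f q = 0 := by
  have h1 : (fun w => f w) =O[𝓝 0] fun w => w := by
    simpa [h0] using hd.isBigO_sub
  have hn : ∀ n : ℕ, f q = 4 ^ n * f (q ^ 2 ^ n) := by
    intro n
    induction n with
    | zero => simp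
    | succ n ih =>
      rw [ih, hf _ (norm_pow_two_pow_lt_one hq n), pow_succ 2 n, pow_mul]; ring
  have h2 : (fun n : ℕ => (4 : ℂ) ^ n * f (q ^ 2 ^ n)) =O[atTop]
      fun n : ℕ => (4 : ℂ) ^ n * q ^ 2 ^ n :=
    (Asymptotics.isBigO_refl _ _).mul (h1.comp_tendsto (tendsto_pow_two_pow hq))
  have h3 : Tendsto (fun n : ℕ => (4 : ℂ) ^ n * q ^ 2 ^ n) atTop (𝓝 0) := by
    have h := (tendsto_pow_const_mul_const_pow_of_abs_lt_one 2
      (r := ‖q‖) (by simpa using hq)).comp (tendsto_pow_atTop_atTop_of_one_lt one_lt_two)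
    rw [tendsto_zero_iff_norm_tendsto_zero]
    refine h.congr fun n => ?_
    simp only [Function.comp_def, norm_mul, norm_pow, Complex.norm_ofNat]
    push_cast
    rw [← pow_mul, mul_comm n 2, pow_mul]; norm_num
  have h4 := h2.trans_tendsto h3
  simp only [← hn] at h4
  exact tendsto_nhds_unique tendsto_const_nhds h4

lemma norm_zero_lt_one_complex : ‖(0 : ℂ)‖ < 1 := by simp

lemma theta4_ne_zero {q : ℂ} (hq : ‖q‖ < 1) : theta4 q ≠ 0 :=
  ne_zero_of_ne_zero_sq (differentiableAt_theta4 norm_zero_lt_one_complex).continuousAt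
    (by simp [theta4_zero])
    (fun p hp h => by
      have := theta3_mul_theta4 hp
      rw [h, mul_zero] at this
      exact pow_eq_zero_iff two_ne_zero |>.1 this.symm) hq

lemma theta3_ne_zero {q : ℂ} (hq : ‖q‖ < 1) : theta3 q ≠ 0 := by
  have := theta4_ne_zero (q := -q) (by simpa using hq)
  rwa [theta4_eq, neg_neg] at this

lemma psi_ne_zero {q : ℂ} (hq : ‖q‖ < 1) : psi q ≠ 0 :=
  ne_zero_of_ne_zero_sq (differentiableAt_psi norm_zero_lt_one_complex).continuousAt
    (by simp [psi_zero])
    (fun p hp h => by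
      have := psi_sq hp
      rw [h] at this
      have h3 := theta3_ne_zero (norm_sq_lt_one hp)
      simpa [h3] using this.symm) hq


/-! ### The operator `D` on functions holomorphic in the unit disc -/

lemma eventually_norm_lt_one {q : ℂ} (hq : ‖q‖ < 1) : ∀ᶠ p in 𝓝 q, ‖p‖ < 1 :=
  continuous_norm.continuousAt.eventually_lt continuousAt_const hq

lemma D_congr {f g : ℂ → ℂ} (h : ∀ p, ‖p‖ < 1 → f p = g p) {q : ℂ} (hq : ‖q‖ < 1) :
    D f q = D g q := by
  rw [D, D, EventuallyEq.deriv_eq ((eventually_norm_lt_one hq).mono h)]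

lemma differentiableAt_D {f : ℂ → ℂ} (h : ∀ p, ‖p‖ < 1 → DifferentiableAt ℂ f p) {q : ℂ}
    (hq : ‖q‖ < 1) : DifferentiableAt ℂ (D f) q := by
  have hf : DifferentiableOn ℂ f (Metric.ball 0 1) := fun p hp =>
    (h p (mem_ball_zero_iff.1 hp)).differentiableWithinAt
  have := (hf.deriv Metric.isOpen_ball).differentiableAt
    (Metric.isOpen_ball.mem_nhds (mem_ball_zero_iff.2 hq))
  exact differentiableAt_id.mul this

lemma D_zero (f : ℂ → ℂ) : D f 0 = 0 := zero_mul _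

section rules

variable {f g : ℂ → ℂ} {q : ℂ}

lemma D_add (hf : DifferentiableAt ℂ f q) (hg : DifferentiableAt ℂ g q) :
    D (fun p => f p + g p) q = D f q + D g q := by
  simp only [D, deriv_fun_add hf hg]; ring

lemma D_mul (hf : DifferentiableAt ℂ f q) (hg : DifferentiableAt ℂ g q) :
    D (fun p => f p * g p) q = D f q * g q + f q * D g q := by
  simp only [D, deriv_fun_mul hf hg]; ring

lemma D_const_mul (c : ℂ) : D (fun p => c * f p) q = c * D f q := by
  simp only [D, deriv_const_mul_field]; ring

lemma D_pow (hf : DifferentiableAt ℂ f q) (n : ℕ) :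
    D (fun p => f p ^ n) q = n * f q ^ (n - 1) * D f q := by
  simp only [D, deriv_fun_pow hf]; ring

lemma D_id : D (fun p => p) q = q := by simp [D]

lemma D_comp_sq (hf : DifferentiableAt ℂ f (q ^ 2)) :
    D (fun p => f (p ^ 2)) q = 2 * D f (q ^ 2) := by
  have h : HasDerivAt (fun p : ℂ => f (p ^ 2)) (deriv f (q ^ 2) * (2 * q)) q := by
    have h := HasDerivAt.comp q hf.hasDerivAt (hasDerivAt_pow 2 q)
    simp only [Nat.cast_ofNat, Nat.add_one_sub_one, pow_one] at h
    exact h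
  simp only [D, h.deriv]; ring

lemma differentiableAt_comp_sq (hf : DifferentiableAt ℂ f (q ^ 2)) :
    DifferentiableAt ℂ (fun p => f (p ^ 2)) q :=
  hf.comp q (differentiableAt_pow 2)

end rules

/-- The logarithmic derivative `D f / f`. -/
def dlog (f : ℂ → ℂ) (q : ℂ) : ℂ := D f q / f q

lemma dlog_zero (f : ℂ → ℂ) : dlog f 0 = 0 := by rw [dlog, D_zero, zero_div]

lemma D_eq_dlog_mul {f : ℂ → ℂ} {q : ℂ} (h : f q ≠ 0) : D f q = dlog f q * f q := by
  rw [dlog, div_mul_cancel₀ _ h]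

lemma differentiableAt_dlog {f : ℂ → ℂ} (h : ∀ p, ‖p‖ < 1 → DifferentiableAt ℂ f p)
    {q : ℂ} (hq : ‖q‖ < 1) (h0 : f q ≠ 0) : DifferentiableAt ℂ (dlog f) q :=
  (differentiableAt_D h hq).div (h q hq) h0

/-! ### Logarithmic derivatives of the theta series -/

lemma dlog_theta3_mul_sq {q : ℂ} (hq : ‖q‖ < 1) :
    2 * theta3 q ^ 2 * dlog theta3 q = 4 * theta3 (q ^ 2) ^ 2 * dlog theta3 (q ^ 2) +
      q * psi (q ^ 2) ^ 2 * (1 + 4 * dlog psi (q ^ 2)) := by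
  have hq2 := norm_sq_lt_one hq
  have d3 := differentiableAt_theta3 hq2
  have dp := differentiableAt_psi hq2
  have c3 := differentiableAt_comp_sq d3
  have cp := differentiableAt_comp_sq dp
  have h := D_congr (fun p hp => theta3_sq hp) hq
  rw [D_pow (differentiableAt_theta3 hq),
    D_add (c3.fun_pow 2) (differentiableAt_fun_id.fun_mul (cp.fun_pow 2)), D_pow c3, D_comp_sq d3,
    D_mul differentiableAt_fun_id (cp.fun_pow 2), D_id, D_pow cp, D_comp_sq dp,
    D_eq_dlog_mul (theta3_ne_zero hq), D_eq_dlog_mul (theta3_ne_zero hq2),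
    D_eq_dlog_mul (psi_ne_zero hq2)] at h
  simp only [Nat.cast_ofNat, Nat.add_one_sub_one, pow_one] at h
  linear_combination h

lemma dlog_theta4_mul_sq {q : ℂ} (hq : ‖q‖ < 1) :
    2 * theta4 q ^ 2 * dlog theta4 q = 4 * theta3 (q ^ 2) ^ 2 * dlog theta3 (q ^ 2) -
      q * psi (q ^ 2) ^ 2 * (1 + 4 * dlog psi (q ^ 2)) := by
  have hq' : ‖-q‖ < 1 := by simpa using hq
  have h := dlog_theta3_mul_sq hq'
  have h4 : dlog theta4 q = dlog theta3 (-q) := by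
    simp only [dlog, D, show theta4 = fun p => theta3 (-p) from funext theta4_eq, deriv_comp_neg]
    ring
  rw [neg_sq] at h
  rw [h4, theta4_eq]
  linear_combination h

lemma dlog_psi {q : ℂ} (hq : ‖q‖ < 1) :
    dlog psi q = dlog psi (q ^ 2) + dlog theta3 (q ^ 2) := by
  have hq2 := norm_sq_lt_one hq
  have d3 := differentiableAt_theta3 hq2
  have dp := differentiableAt_psi hq2
  have c3 := differentiableAt_comp_sq d3
  have cp := differentiableAt_comp_sq dp
  have h := D_congr (fun p hp => psi_sq hp) hq
  rw [D_pow (differentiableAt_psi hq), D_const_mul, D_mul cp c3, D_comp_sq d3, D_comp_sq dp,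
    D_eq_dlog_mul (psi_ne_zero hq), D_eq_dlog_mul (theta3_ne_zero hq2),
    D_eq_dlog_mul (psi_ne_zero hq2)] at h
  simp only [Nat.cast_ofNat, Nat.add_one_sub_one, pow_one] at h
  refine mul_left_cancel₀ (pow_ne_zero 2 (psi_ne_zero hq)) ?_
  linear_combination h / 2 - (dlog psi (q ^ 2) + dlog theta3 (q ^ 2)) * psi_sq hq

lemma dlog_theta4_sq {q : ℂ} (hq : ‖q‖ < 1) :
    4 * dlog theta4 (q ^ 2) = dlog theta3 q + dlog theta4 q := by
  have hq2 := norm_sq_lt_one hq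
  have d4 := differentiableAt_theta4 hq2
  have h := D_congr (fun p hp => theta3_mul_theta4 hp) hq
  rw [D_mul (differentiableAt_theta3 hq) (differentiableAt_theta4 hq),
    D_pow (differentiableAt_comp_sq d4), D_comp_sq d4,
    D_eq_dlog_mul (theta3_ne_zero hq), D_eq_dlog_mul (theta4_ne_zero hq),
    D_eq_dlog_mul (theta4_ne_zero hq2)] at h
  simp only [Nat.cast_ofNat, Nat.add_one_sub_one, pow_one] at h
  refine mul_left_cancel₀ (pow_ne_zero 2 (theta4_ne_zero hq2)) ?_
  linear_combination -h + (dlog theta3 q + dlog theta4 q) * theta3_mul_theta4 hq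

lemma theta4_sq_pow_four {q : ℂ} (hq : ‖q‖ < 1) :
    theta4 (q ^ 2) ^ 4 = theta3 q ^ 2 * theta4 q ^ 2 := by
  rw [show theta4 (q ^ 2) ^ 4 = (theta4 (q ^ 2) ^ 2) ^ 2 by ring, ← theta3_mul_theta4 hq]; ring

/-- `D log (θ₂⁴ / θ₃⁴) = θ₄⁴`. -/
lemma dlog_psi_sub_dlog_theta3 {q : ℂ} (hq : ‖q‖ < 1) :
    1 + 4 * dlog psi q - 4 * dlog theta3 q = theta4 q ^ 4 := by
  have h4 := pow_ne_zero 4 (theta4_ne_zero hq)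
  have h0 : ‖(0 : ℂ)‖ < 1 := norm_zero_lt_one_complex
  have key := eq_value_zero_of_eq_sq
    (f := fun p => (1 + 4 * dlog psi p - 4 * dlog theta3 p) / theta4 p ^ 4) ?_ ?_ hq
  · simp only [dlog_zero, theta4_zero] at key
    rw [div_eq_iff h4] at key
    rw [key]; ring
  · refine ContinuousAt.div₀ ?_
      ((differentiableAt_theta4 h0).continuousAt.pow 4) (by simp [theta4_zero])
    exact (continuousAt_const.add (continuousAt_const.mul
      (differentiableAt_dlog (fun _ => differentiableAt_psi) h0 (psi_ne_zero h0)).continuousAt)).sub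
      (continuousAt_const.mul
      (differentiableAt_dlog (fun _ => differentiableAt_theta3) h0
        (theta3_ne_zero h0)).continuousAt)
  · intro p hp
    rw [theta4_sq_pow_four hp, div_eq_div_iff (pow_ne_zero 4 (theta4_ne_zero hp))
      (mul_ne_zero (pow_ne_zero 2 (theta3_ne_zero hp)) (pow_ne_zero 2 (theta4_ne_zero hp)))]
    -- With L the numerator, L(p) θ₃(p)² = L(p²) θ₄(p)². Since θ₄(p²)⁴ = θ₃(p)² θ₄(p)², the quotient
    -- L / θ₄⁴ is invariant.
    have e : (1 + 4 * dlog psi p - 4 * dlog theta3 p) * theta3 p ^ 2 =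
        (1 + 4 * dlog psi (p ^ 2) - 4 * dlog theta3 (p ^ 2)) * theta4 p ^ 2 := by
      rw [dlog_psi hp]
      linear_combination -2 * dlog_theta3_mul_sq hp +
        (1 + 4 * dlog psi (p ^ 2) + 4 * dlog theta3 (p ^ 2)) * theta3_sq hp -
        (1 + 4 * dlog psi (p ^ 2) - 4 * dlog theta3 (p ^ 2)) * theta4_sq hp
    linear_combination theta4 p ^ 2 * e

/-- `D log (θ₃⁴ / θ₄⁴) = θ₂⁴`. -/
lemma dlog_theta3_sub_dlog_theta4 {q : ℂ} (hq : ‖q‖ < 1) :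
    4 * dlog theta3 q - 4 * dlog theta4 q = q * psi q ^ 4 := by
  refine mul_left_cancel₀ (mul_ne_zero (pow_ne_zero 2 (theta3_ne_zero hq))
    (pow_ne_zero 2 (theta4_ne_zero hq))) ?_
  have hL := dlog_psi_sub_dlog_theta3 (norm_sq_lt_one hq)
  rw [theta4_sq_pow_four hq] at hL
  have e3 := dlog_theta3_mul_sq hq
  have e4 := dlog_theta4_mul_sq hq
  have s3 := theta3_sq hq
  have s4 := theta4_sq hq
  rw [show psi q ^ 4 = (psi q ^ 2) ^ 2 by ring, psi_sq hq]
  have h1 : theta3 q ^ 2 * theta4 q ^ 2 * (4 * dlog theta3 q - 4 * dlog theta4 q) =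
      2 * theta4 q ^ 2 * (2 * theta3 q ^ 2 * dlog theta3 q) -
      2 * theta3 q ^ 2 * (2 * theta4 q ^ 2 * dlog theta4 q) := by ring
  rw [h1, e3, e4, ← hL, s3, s4]
  ring

/-! ### The differential system -/

/-- The combination `24 D log θ₄ + θ₂⁴ + θ₃⁴`, shown below to be `E₂`. -/
def thetaE (q : ℂ) : ℂ := 24 * dlog theta4 q + q * psi q ^ 4 + theta3 q ^ 4

lemma differentiableAt_theta2_pow {q : ℂ} (hq : ‖q‖ < 1) :
    DifferentiableAt ℂ (fun p => p * psi p ^ 4) q :=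
  differentiableAt_id.mul ((differentiableAt_psi hq).pow 4)

lemma differentiableAt_theta3_pow {q : ℂ} (hq : ‖q‖ < 1) :
    DifferentiableAt ℂ (fun p => theta3 p ^ 4) q :=
  (differentiableAt_theta3 hq).pow 4

lemma differentiableAt_thetaE {q : ℂ} (hq : ‖q‖ < 1) : DifferentiableAt ℂ thetaE q :=
  (((differentiableAt_dlog (fun _ => differentiableAt_theta4) hq
    (theta4_ne_zero hq)).const_mul 24).add (differentiableAt_theta2_pow hq)).add
    (differentiableAt_theta3_pow hq)

lemma D_theta4 {q : ℂ} (hq : ‖q‖ < 1) :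
    D theta4 q = theta4 q * ((thetaE q - q * psi q ^ 4 - theta3 q ^ 4) / 24) := by
  rw [D_eq_dlog_mul (theta4_ne_zero hq), thetaE]; ring

lemma D_theta2_pow {q : ℂ} (hq : ‖q‖ < 1) :
    D (fun p => p * psi p ^ 4) q =
      q * psi q ^ 4 * (thetaE q + 5 * theta3 q ^ 4 - q * psi q ^ 4) / 6 := by
  have dp := differentiableAt_psi hq
  rw [D_mul differentiableAt_fun_id (dp.fun_pow 4), D_id, D_pow dp,
    D_eq_dlog_mul (psi_ne_zero hq), thetaE]
  simp only [Nat.cast_ofNat, Nat.add_one_sub_one]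
  linear_combination q * psi q ^ 4 * (dlog_psi_sub_dlog_theta3 hq +
    dlog_theta3_sub_dlog_theta4 hq - theta3_pow_four hq)

lemma D_theta3_pow {q : ℂ} (hq : ‖q‖ < 1) :
    D (fun p => theta3 p ^ 4) q =
      theta3 q ^ 4 * (thetaE q + 5 * (q * psi q ^ 4) - theta3 q ^ 4) / 6 := by
  rw [D_pow (differentiableAt_theta3 hq), D_eq_dlog_mul (theta3_ne_zero hq), thetaE]
  simp only [Nat.cast_ofNat, Nat.add_one_sub_one]
  linear_combination theta3 q ^ 4 * dlog_theta3_sub_dlog_theta4 hq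

/-- With `theta_pow_mul_sq`, this expresses the elementary symmetric functions of x(q²), y(q²)
through x(q), y(q), as needed to transform x² + 14xy + y². -/
lemma theta_pow_add_sq {q : ℂ} (hq : ‖q‖ < 1) :
    2 * (q ^ 2 * psi (q ^ 2) ^ 4 + theta3 (q ^ 2) ^ 4) = 2 * theta3 q ^ 4 - q * psi q ^ 4 := by
  have h : theta3 q ^ 4 + theta4 q ^ 4 =
      2 * (q ^ 2 * psi (q ^ 2) ^ 4 + theta3 (q ^ 2) ^ 4) := by
    rw [show theta3 q ^ 4 = (theta3 q ^ 2) ^ 2 by ring,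
      show theta4 q ^ 4 = (theta4 q ^ 2) ^ 2 by ring, theta3_sq hq, theta4_sq hq]
    ring
  linear_combination -h - theta3_pow_four hq

lemma theta_pow_mul_sq {q : ℂ} (hq : ‖q‖ < 1) :
    16 * (q ^ 2 * psi (q ^ 2) ^ 4 * theta3 (q ^ 2) ^ 4) = (q * psi q ^ 4) ^ 2 := by
  rw [show (q * psi q ^ 4) ^ 2 = q ^ 2 * (psi q ^ 2) ^ 4 by ring, psi_sq hq]; ring

lemma thetaE_sq {q : ℂ} (hq : ‖q‖ < 1) :
    2 * thetaE (q ^ 2) = thetaE q + q * psi q ^ 4 + theta3 q ^ 4 := by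
  simp only [thetaE]
  linear_combination 12 * dlog_theta4_sq hq + theta_pow_add_sq hq +
    3 * dlog_theta3_sub_dlog_theta4 hq

lemma D_thetaE {q : ℂ} (hq : ‖q‖ < 1) :
    D thetaE q = (thetaE q ^ 2 - (q * psi q ^ 4) ^ 2 - 14 * (q * psi q ^ 4) * theta3 q ^ 4 -
      (theta3 q ^ 4) ^ 2) / 12 := by
  have h0 : ‖(0 : ℂ)‖ < 1 := norm_zero_lt_one_complex
  rw [← sub_eq_zero]
  refine eq_zero_of_eq_four_mul_sq (f := fun q => D thetaE q - (thetaE q ^ 2 -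
    (q * psi q ^ 4) ^ 2 - 14 * (q * psi q ^ 4) * theta3 q ^ 4 - (theta3 q ^ 4) ^ 2) / 12)
    ?_ ?_ ?_ hq
  · have hx := differentiableAt_theta2_pow h0
    have hy := differentiableAt_theta3_pow h0
    exact (differentiableAt_D (fun _ => differentiableAt_thetaE) h0).sub
      ((((((differentiableAt_thetaE h0).pow 2).sub (hx.pow 2)).sub
        ((hx.const_mul 14).mul hy)).sub (hy.pow 2)).div_const 12)
  · simp [D_zero, thetaE, dlog_zero, theta3_zero]
  · intro p hp
    have hp2 := norm_sq_lt_one hp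
    have hE := thetaE_sq hp
    -- Differentiating 2E(q²) = E + x + y gives 4(DE)(q²) = DE + Dx + Dy, the source of the factor
    -- 4.
    have h := D_congr (fun p hp => thetaE_sq hp) hp
    rw [D_const_mul, D_comp_sq (differentiableAt_thetaE hp2),
      D_add ((differentiableAt_thetaE hp).fun_add (differentiableAt_theta2_pow hp))
        (differentiableAt_theta3_pow hp),
      D_add (differentiableAt_thetaE hp) (differentiableAt_theta2_pow hp),
      D_theta2_pow hp, D_theta3_pow hp] at h
    have ha := theta_pow_add_sq hp
    have hm := theta_pow_mul_sq hp
    generalize thetaE (p ^ 2) = E' at *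
    generalize p ^ 2 * psi (p ^ 2) ^ 4 = x' at *
    generalize theta3 (p ^ 2) ^ 4 = y' at *
    generalize p * psi p ^ 4 = x at *
    generalize theta3 p ^ 4 = y at *
    linear_combination -h + (2 * E' + thetaE p + x + y) / 12 * hE -
      (2 * (x' + y') + 2 * y - x) / 12 * ha - hm / 4


/-! ### Gauss's product for `θ₄` -/

/-- The finite product `∏_{j=1}^{n} (1 - p ^ j)`. -/
def qPoch (p : ℂ) (n : ℕ) : ℂ := ∏ j ∈ Finset.range n, (1 - p ^ (j + 1))

/-- The Euler product `∏_{j ≥ 1} (1 - p ^ j)`. -/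
def eulerPhi (p : ℂ) : ℂ := ∏' j : ℕ, (1 - p ^ (j + 1))

/-- The reciprocal of `∏_{j=1}^{n} (1 - p ^ j)`, extended by zero to negative `n`. -/
def invPoch (p : ℂ) (n : ℤ) : ℂ := if 0 ≤ n then (qPoch p n.toNat)⁻¹ else 0

lemma one_sub_pow_succ_ne_zero {p : ℂ} (hp : ‖p‖ < 1) (j : ℕ) : 1 - p ^ (j + 1) ≠ 0 := by
  intro h
  have h1 : ‖p ^ (j + 1)‖ < 1 := by
    rw [norm_pow]; exact pow_lt_one₀ (norm_nonneg _) hp (by omega)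
  rw [← sub_eq_zero.1 h] at h1
  simp at h1

lemma qPoch_ne_zero {p : ℂ} (hp : ‖p‖ < 1) (n : ℕ) : qPoch p n ≠ 0 :=
  Finset.prod_ne_zero_iff.2 fun j _ => one_sub_pow_succ_ne_zero hp j

lemma eulerPhi_ne_zero {p : ℂ} (hp : ‖p‖ < 1) : eulerPhi p ≠ 0 := by
  have h := tprod_one_add_ne_zero_of_summable (f := fun j : ℕ => -p ^ (j + 1))
    (fun j => by simpa [← sub_eq_add_neg] using one_sub_pow_succ_ne_zero hp j)
    (by simpa using (summable_nat_add_iff 1).2 (summable_geometric_of_lt_one (norm_nonneg _) hp))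
  simpa [eulerPhi, sub_eq_add_neg] using h

lemma tendsto_qPoch {p : ℂ} (hp : ‖p‖ < 1) : Tendsto (qPoch p) atTop (𝓝 (eulerPhi p)) :=
  (ModularForm.multipliable_one_sub_pow hp).tendsto_prod_tprod_nat

/-- The extension by zero is consistent because 1 - p^0 = 0; hence boundary indices need no separate
treatment. -/
lemma invPoch_sub_one {p : ℂ} (hp : ‖p‖ < 1) (n : ℤ) :
    invPoch p (n - 1) = (1 - p ^ n) * invPoch p n := by
  rcases lt_trichotomy n 0 with h | rfl | h
  · rw [invPoch, invPoch, if_neg (by omega), if_neg (by omega), mul_zero]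
  · simp [invPoch]
  · obtain ⟨m, rfl⟩ : ∃ m : ℕ, n = m + 1 := ⟨(n - 1).toNat, by omega⟩
    have hm := qPoch_ne_zero hp m
    have hj := one_sub_pow_succ_ne_zero hp m
    rw [invPoch, invPoch, if_pos (by omega), if_pos (by omega), add_sub_cancel_right,
      Int.toNat_natCast, show ((m : ℤ) + 1).toNat = m + 1 by omega,
      show qPoch p (m + 1) = qPoch p m * (1 - p ^ (m + 1)) from Finset.prod_range_succ _ _,
      show p ^ ((m : ℤ) + 1) = p ^ (m + 1) by exact_mod_cast zpow_natCast p (m + 1)]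
    field_simp

lemma tendsto_invPoch {p : ℂ} (hp : ‖p‖ < 1) :
    Tendsto (invPoch p) atTop (𝓝 (eulerPhi p)⁻¹) := by
  have h : Tendsto (fun n : ℤ => (qPoch p n.toNat)⁻¹) atTop (𝓝 (eulerPhi p)⁻¹) :=
    ((tendsto_qPoch hp).inv₀ (eulerPhi_ne_zero hp)).comp
      (tendsto_atTop_atTop.2 fun b => ⟨b, fun a ha => by omega⟩)
  refine h.congr' ?_
  filter_upwards [eventually_ge_atTop 0] with n hn
  rw [invPoch, if_pos hn]

lemma exists_norm_invPoch_le {p : ℂ} (hp : ‖p‖ < 1) : ∃ C, ∀ n, ‖invPoch p n‖ ≤ C := by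
  obtain ⟨C, hC⟩ := (Metric.isBounded_range_of_tendsto _
    ((tendsto_qPoch hp).inv₀ (eulerPhi_ne_zero hp))).exists_norm_le
  refine ⟨C, fun n => ?_⟩
  rw [invPoch]
  split_ifs
  · exact hC _ ⟨_, rfl⟩
  · rw [norm_zero]; exact (norm_nonneg _).trans (hC _ ⟨0, rfl⟩)

/-- The coefficient of `z ^ k` in `∏_{j=1}^{N} (1 + z q^{2j-1}) (1 + z⁻¹ q^{2j-1})`, divided by
`∏_{j=1}^{2N} (1 - q^{2j})`. -/
def tripleCoeff (q : ℂ) (N : ℕ) (k : ℤ) : ℂ :=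
  q ^ (k ^ 2) * (invPoch (q ^ 2) (N - k) * invPoch (q ^ 2) (N + k))

/-- This compares coefficients of z^k after multiplying by the new factors (1 + z q^(2N+1))(1 + z⁻¹
q^(2N+1)). -/
lemma tripleCoeff_succ {q : ℂ} (h0 : q ≠ 0) (hq : ‖q‖ < 1) (N : ℕ) (k : ℤ) :
    (1 - q ^ (4 * N + 2)) * (1 - q ^ (4 * N + 4)) * tripleCoeff q (N + 1) k =
      (1 + q ^ (4 * N + 2)) * tripleCoeff q N k +
        q ^ (2 * N + 1) * (tripleCoeff q N (k - 1) + tripleCoeff q N (k + 1)) := by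
  have hp := norm_sq_lt_one hq
  have hp0 : q ^ 2 ≠ 0 := pow_ne_zero 2 h0
  simp only [tripleCoeff]
  set r := invPoch (q ^ 2) with hr
  set u : ℂ := q ^ (2 * ((N : ℤ) - k)) with hu
  set v : ℂ := q ^ (2 * ((N : ℤ) + k)) with hv
  have pz (n : ℤ) : (q ^ 2) ^ n = q ^ (2 * n) := by rw [zpow_mul]; norm_cast
  have r1 : r (N - k) = (1 - q ^ 2 * u) * r ((N + 1 : ℕ) - k) := by
    have := invPoch_sub_one hp ((N + 1 : ℕ) - k)
    rw [pz, show ((N + 1 : ℕ) - k - 1 : ℤ) = N - k by push_cast; ring] at this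
    rw [hr, this, hu, ← zpow_natCast q 2, ← zpow_add₀ h0]
    congr 3; push_cast; ring
  have r2 : r (N + k) = (1 - q ^ 2 * v) * r ((N + 1 : ℕ) + k) := by
    have := invPoch_sub_one hp ((N + 1 : ℕ) + k)
    rw [pz, show ((N + 1 : ℕ) + k - 1 : ℤ) = N + k by push_cast; ring] at this
    rw [hr, this, hv, ← zpow_natCast q 2, ← zpow_add₀ h0]
    congr 3; push_cast; ring
  have r3 : r (N - (k + 1)) = (1 - u) * r (N - k) := by
    have := invPoch_sub_one hp (N - k)
    rw [pz] at this
    rw [← sub_sub, hr, this]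
  have r4 : r (N + (k - 1)) = (1 - v) * r (N + k) := by
    have := invPoch_sub_one hp (N + k)
    rw [pz] at this
    rw [← add_sub_assoc, hr, this]
  have r5 : r (N - (k - 1)) = r ((N + 1 : ℕ) - k) := by congr 1; push_cast; ring
  have r6 : r (N + (k + 1)) = r ((N + 1 : ℕ) + k) := by congr 1; push_cast; ring
  have uv : u * v = q ^ (4 * N) := by
    rw [hu, hv, ← zpow_add₀ h0, ← zpow_natCast]; congr 1; push_cast; ring
  have e1 : q ^ (2 * N + 1) * q ^ ((k - 1) ^ 2) = q ^ (k ^ 2) * (q ^ 2 * u) := by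
    rw [hu, ← zpow_natCast q 2, ← zpow_add₀ h0, ← zpow_add₀ h0, ← zpow_natCast, ← zpow_add₀ h0]
    congr 1; push_cast; ring
  have e2 : q ^ (2 * N + 1) * q ^ ((k + 1) ^ 2) = q ^ (k ^ 2) * (q ^ 2 * v) := by
    rw [hv, ← zpow_natCast q 2, ← zpow_add₀ h0, ← zpow_add₀ h0, ← zpow_natCast, ← zpow_add₀ h0]
    congr 1; push_cast; ring
  rw [mul_add, ← mul_assoc (q ^ (2 * N + 1)), ← mul_assoc (q ^ (2 * N + 1)), e1, e2, r3, r4, r5, r6,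
    r1, r2, pow_add q (4 * N) 2, pow_add q (4 * N) 4, ← uv]
  ring

lemma tripleCoeff_eq_zero (q : ℂ) {N : ℕ} {k : ℤ} (h : k ∉ Finset.Icc (-(N : ℤ)) N) :
    tripleCoeff q N k = 0 := by
  rw [Finset.mem_Icc, not_and_or] at h
  rw [tripleCoeff, invPoch, invPoch]
  rcases h with h | h
  · rw [if_neg (show ¬ (0 ≤ (N : ℤ) + k) by omega)]; simp
  · rw [if_neg (show ¬ (0 ≤ (N : ℤ) - k) by omega)]; simp

lemma summable_tripleCoeff (q : ℂ) (N : ℕ) : Summable fun k : ℤ => (-1) ^ k * tripleCoeff q N k :=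
  summable_of_ne_finset_zero (s := Finset.Icc (-(N : ℤ)) N) fun k hk => by
    rw [tripleCoeff_eq_zero q hk, mul_zero]

/-- The finite form of Gauss's product. -/
lemma tsum_tripleCoeff {q : ℂ} (h0 : q ≠ 0) (hq : ‖q‖ < 1) (N : ℕ) :
    qPoch (q ^ 2) (2 * N) * ∑' k : ℤ, (-1) ^ k * tripleCoeff q N k =
      ∏ j ∈ Finset.range N, (1 - q ^ (2 * j + 1)) ^ 2 := by
  induction N with
  | zero =>
    rw [tsum_eq_single 0]
    · simp [tripleCoeff, invPoch, qPoch]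
    · intro k hk
      rw [tripleCoeff_eq_zero, mul_zero]
      simpa using hk
  | succ N ih =>
    have hs := summable_tripleCoeff q N
    -- Shifting k changes the sign, so the step multiplies the sum by 1 + q^(4N+2) - 2q^(2N+1) = (1
    -- - q^(2N+1))².
    have h1 : HasSum (fun k : ℤ => (-1) ^ k * tripleCoeff q N (k - 1))
        (-∑' k : ℤ, (-1) ^ k * tripleCoeff q N k) := by
      rw [← (Equiv.addRight (1 : ℤ)).hasSum_iff]
      refine hs.hasSum.neg.congr_fun fun k => ?_
      simp [zpow_add₀]
    have h2 : HasSum (fun k : ℤ => (-1) ^ k * tripleCoeff q N (k + 1))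
        (-∑' k : ℤ, (-1) ^ k * tripleCoeff q N k) := by
      rw [← (Equiv.addRight (-1 : ℤ)).hasSum_iff]
      refine hs.hasSum.neg.congr_fun fun k => ?_
      simp [zpow_sub₀, ← sub_eq_add_neg, div_neg]
    have h3 := (hs.hasSum.mul_left (1 + q ^ (4 * N + 2))).add
      ((h1.add h2).mul_left (q ^ (2 * N + 1)))
    have h4 : (1 - q ^ (4 * N + 2)) * (1 - q ^ (4 * N + 4)) *
        ∑' k : ℤ, (-1) ^ k * tripleCoeff q (N + 1) k =
        (1 - q ^ (2 * N + 1)) ^ 2 * ∑' k : ℤ, (-1) ^ k * tripleCoeff q N k := by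
      rw [← tsum_mul_left, tsum_congr fun k => ?_, h3.tsum_eq]
      · ring
      · linear_combination (-1 : ℂ) ^ k * tripleCoeff_succ h0 hq N k
    rw [Finset.prod_range_succ, ← ih, show 2 * (N + 1) = 2 * N + 1 + 1 by ring]
    simp only [qPoch]
    rw [Finset.prod_range_succ, Finset.prod_range_succ, ← pow_mul, ← pow_mul,
      show 2 * (2 * N + 1) = 4 * N + 2 by ring, show 2 * (2 * N + 1 + 1) = 4 * N + 4 by ring]
    linear_combination (∏ x ∈ Finset.range (2 * N), (1 - (q ^ 2) ^ (x + 1))) * h4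

lemma tendsto_tsum_tripleCoeff {q : ℂ} (hq : ‖q‖ < 1) :
    Tendsto (fun N : ℕ => qPoch (q ^ 2) (2 * N) * ∑' k : ℤ, (-1) ^ k * tripleCoeff q N k) atTop
      (𝓝 (theta4 q * (eulerPhi (q ^ 2))⁻¹)) := by
  have hp := norm_sq_lt_one hq
  obtain ⟨C, hC⟩ := exists_norm_invPoch_le hp
  have hlim : Tendsto (fun N : ℕ => ∑' k : ℤ, (-1) ^ k * tripleCoeff q N k) atTop
      (𝓝 (∑' k : ℤ, (-1) ^ k * (q ^ (k ^ 2) * ((eulerPhi (q ^ 2))⁻¹ * (eulerPhi (q ^ 2))⁻¹)))) := by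
    refine tendsto_tsum_of_dominated_convergence
      (bound := fun k => ‖q ^ (k.natAbs ^ 2)‖ * (C * C))
      ((summable_norm_intPow natAbs_le_sq_exponent hq).mul_right _) (fun k => ?_)
      (.of_forall fun N k => ?_)
    · refine tendsto_const_nhds.mul (tendsto_const_nhds.mul (Tendsto.mul ?_ ?_))
      · exact (tendsto_invPoch hp).comp
          (tendsto_atTop_add_const_right _ (-k) tendsto_natCast_atTop_atTop)
      · exact (tendsto_invPoch hp).comp
          (tendsto_atTop_add_const_right _ k tendsto_natCast_atTop_atTop)
    · rw [norm_mul, norm_zpow, norm_neg, norm_one, one_zpow, one_mul, tripleCoeff, norm_mul,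
        norm_mul, zpow_sq]
      have hC0 : 0 ≤ C := (norm_nonneg _).trans (hC 0)
      gcongr <;> exact hC _
  have h2 : Tendsto (fun N : ℕ => qPoch (q ^ 2) (2 * N)) atTop (𝓝 (eulerPhi (q ^ 2))) :=
    (tendsto_qPoch hp).comp (tendsto_id.const_mul_atTop' two_pos)
  convert h2.mul hlim using 2
  have h0 := eulerPhi_ne_zero hp
  rw [theta4, ← tsum_mul_left, ← tsum_mul_right]
  refine tsum_congr fun k => ?_
  field_simp

lemma multipliable_one_sub_odd_pow {q : ℂ} (hq : ‖q‖ < 1) :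
    Multipliable fun j : ℕ => 1 - q ^ (2 * j + 1) := by
  have h : Summable fun j : ℕ => ‖-q ^ (2 * j + 1)‖ := by
    have := (summable_geometric_of_lt_one (norm_nonneg _) hq).comp_injective
      (i := fun j : ℕ => 2 * j + 1) (fun a b h => by simpa using h)
    simpa [Function.comp_def] using this
  simpa [sub_eq_add_neg] using multipliable_one_add_of_summable h

/-- Gauss's identity `θ₄(q) ∏ (1 - q^{2n}) = ∏ (1 - q^n)²`. -/
lemma theta4_mul_eulerPhi_sq {q : ℂ} (hq : ‖q‖ < 1) :
    theta4 q * eulerPhi (q ^ 2) = eulerPhi q ^ 2 := by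
  rcases eq_or_ne q 0 with rfl | h0
  · simp [theta4_zero, eulerPhi]
  have hp := norm_sq_lt_one hq
  have hodd := multipliable_one_sub_odd_pow hq
  have heven : eulerPhi (q ^ 2) = ∏' j : ℕ, (1 - q ^ (2 * j + 1 + 1)) :=
    tprod_congr fun j => by rw [← pow_mul, mul_add_one]
  have hsplit : eulerPhi q = (∏' j : ℕ, (1 - q ^ (2 * j + 1))) * eulerPhi (q ^ 2) := by
    rw [heven, eulerPhi, ← tprod_even_mul_odd (f := fun j => 1 - q ^ (j + 1)) hodd]
    refine (ModularForm.multipliable_one_sub_pow hp).congr fun j => ?_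
    rw [← pow_mul, mul_add_one]
  have hlim : Tendsto (fun N : ℕ => ∏ j ∈ Finset.range N, (1 - q ^ (2 * j + 1)) ^ 2) atTop
      (𝓝 ((∏' j : ℕ, (1 - q ^ (2 * j + 1))) ^ 2)) := by
    simp only [Finset.prod_pow]
    exact hodd.tendsto_prod_tprod_nat.pow 2
  have h := tendsto_nhds_unique hlim
    ((tendsto_tsum_tripleCoeff hq).congr fun N => tsum_tripleCoeff h0 hq N)
  rw [hsplit, mul_pow, h]
  have := eulerPhi_ne_zero hp
  field_simp

/-! ### The Eisenstein series `E₂` -/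

lemma differentiableAt_eulerPhi {q : ℂ} (hq : ‖q‖ < 1) : DifferentiableAt ℂ eulerPhi q :=
  ModularForm.differentiableOn_tprod_one_sub_pow.differentiableAt
    (Metric.isOpen_ball.mem_nhds (mem_ball_zero_iff.2 hq))

lemma eisenstein_one (q : ℂ) : eisenstein 1 q =
    1 - 24 * ∑' n : ℕ+, (ArithmeticFunction.sigma 1 (n : ℕ) : ℂ) * q ^ (n : ℕ) := by
  simp only [eisenstein, mul_one, bernoulli_two]
  norm_num

/-- Termwise logarithmic differentiation gives the Lambert series -∑ n q^n / (1 - q^n), which is -∑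
σ₁(n) q^n. -/
lemma dlog_eulerPhi {q : ℂ} (hq : ‖q‖ < 1) : 24 * dlog eulerPhi q = eisenstein 1 q - 1 := by
  rw [eisenstein_one]
  rcases eq_or_ne q 0 with rfl | h0
  · simp [dlog_zero]
  have hterm (n : ℕ) : logDeriv (fun p : ℂ => 1 - p ^ (n + 1)) q =
      -q⁻¹ * (((n + 1 : ℕ) : ℂ) ^ 1 * q ^ (n + 1) / (1 - q ^ (n + 1))) := by
    have hn := one_sub_pow_succ_ne_zero hq n
    rw [logDeriv_apply, deriv_const_sub, deriv_pow_field]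
    push_cast
    field_simp
    simp [pow_succ]
  have hsum : Summable fun n : ℕ => logDeriv (fun p : ℂ => 1 - p ^ (n + 1)) q := by
    have := summable_norm_pow_mul_geometric_div_one_sub 1 hq
    simp only [hterm]
    exact ((summable_nat_add_iff 1).2 this).mul_left _
  have h := logDeriv_tprod_eq_tsum Metric.isOpen_ball (mem_ball_zero_iff.2 hq)
    (f := fun (n : ℕ) (p : ℂ) => 1 - p ^ (n + 1)) (one_sub_pow_succ_ne_zero hq)
    (fun n => by fun_prop) hsum ModularForm.multipliableLocallyUniformlyOn_one_sub_pow
    (eulerPhi_ne_zero hq)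
  have hd : dlog eulerPhi q = q * logDeriv (fun p => ∏' n : ℕ, (1 - p ^ (n + 1))) q := by
    rw [logDeriv_apply, dlog, D, mul_div_assoc]; rfl
  rw [hd, h, tsum_congr hterm, tsum_mul_left, ← tsum_pow_div_one_sub_eq_tsum_sigma hq 1,
    tsum_pnat_eq_tsum_succ (f := fun n : ℕ => (n : ℂ) ^ 1 * q ^ n / (1 - q ^ n))]
  field_simp
  ring

lemma dlog_theta4_eq {q : ℂ} (hq : ‖q‖ < 1) :
    24 * dlog theta4 q = 2 * eisenstein 1 q - 2 * eisenstein 1 (q ^ 2) := by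
  have hq2 := norm_sq_lt_one hq
  have dphi := differentiableAt_eulerPhi hq2
  have h := D_congr (fun p hp => theta4_mul_eulerPhi_sq hp) hq
  rw [D_mul (differentiableAt_theta4 hq) (differentiableAt_comp_sq dphi), D_comp_sq dphi,
    D_pow (differentiableAt_eulerPhi hq), D_eq_dlog_mul (theta4_ne_zero hq),
    D_eq_dlog_mul (eulerPhi_ne_zero hq), D_eq_dlog_mul (eulerPhi_ne_zero hq2)] at h
  simp only [Nat.cast_ofNat, Nat.add_one_sub_one, pow_one] at h
  have key : dlog theta4 q + 2 * dlog eulerPhi (q ^ 2) = 2 * dlog eulerPhi q := by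
    refine mul_left_cancel₀ (pow_ne_zero 2 (eulerPhi_ne_zero hq)) ?_
    linear_combination h -
      (dlog theta4 q + 2 * dlog eulerPhi (q ^ 2)) * theta4_mul_eulerPhi_sq hq
  linear_combination 24 * key + 2 * dlog_eulerPhi hq - 2 * dlog_eulerPhi hq2

lemma eisenstein_one_eq_thetaE {q : ℂ} (hq : ‖q‖ < 1) : eisenstein 1 q = thetaE q := by
  have h0 : ‖(0 : ℂ)‖ < 1 := norm_zero_lt_one_complex
  have hc : ContinuousAt (eisenstein 1) 0 := by
    have h : ContinuousAt (fun q => 24 * dlog eulerPhi q + 1) 0 :=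
      (continuousAt_const.mul (differentiableAt_dlog (fun _ => differentiableAt_eulerPhi) h0
        (eulerPhi_ne_zero h0)).continuousAt).add continuousAt_const
    refine h.congr ((eventually_norm_lt_one h0).mono fun p hp => ?_)
    linear_combination dlog_eulerPhi hp
  have h := eq_value_zero_of_eq_sq (f := fun p => eisenstein 1 p - thetaE p)
    (hc.sub (differentiableAt_thetaE h0).continuousAt) (fun p hp => ?_) hq
  · have hE : eisenstein 1 0 = 1 := by simp [eisenstein_one]
    simp only [hE, thetaE, dlog_zero, theta3_zero] at h
    rw [thetaE]
    linear_combination h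
  · have h1 := dlog_theta4_eq hp
    have h2 := thetaE_sq hp
    have h3 : thetaE p = 24 * dlog theta4 p + p * psi p ^ 4 + theta3 p ^ 4 := rfl
    linear_combination -h1 / 2 + h2 / 2 - h3 / 2


/-! ### The coefficients `cc` -/

lemma cc_eq_zero {α β γ : ℤ} (h : α < 0 ∨ β < 0 ∨ γ < 0) : cc α β γ = 0 := by
  rw [cc, if_pos h]

lemma cc_zero : cc 0 0 0 = 1 := by
  rw [cc, if_neg (by simp), if_pos (by simp)]

lemma cc_rec {α β γ : ℤ} (h : ¬(α = 0 ∧ β = 0 ∧ γ = 0)) :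
    cc α β γ = (2 * α + 4 * β + 4 * γ - 1) / 24 * cc (α - 1) β γ
    + (20 * γ - 4 * β + 3) / 24 * cc α (β - 1) γ
    + (20 * β - 4 * γ + 3) / 24 * cc α β (γ - 1)
    - 7 * (α + 1) / 6 * cc (α + 1) (β - 1) (γ - 1)
    - (α + 1) / 12 * cc (α + 1) (β - 2) γ
    - (α + 1) / 12 * cc (α + 1) β (γ - 2) := by
  by_cases hneg : α < 0 ∨ β < 0 ∨ γ < 0
  · rw [cc_eq_zero hneg, cc_eq_zero (α := α - 1) (by omega), cc_eq_zero (β := β - 1) (by omega),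
      cc_eq_zero (γ := γ - 1) (by omega)]
    -- At α = -1 the terms with first argument α + 1 = 0 need not vanish, but their coefficients
    -- contain α + 1.
    rcases eq_or_ne α (-1) with rfl | hα
    · norm_num
    · rw [cc_eq_zero (α := α + 1) (β := β - 1) (by omega), cc_eq_zero (β := β - 2) (by omega),
        cc_eq_zero (γ := γ - 2) (by omega)]
      ring
  · rw [cc, if_neg hneg, if_neg h]

lemma cc_symm (α β γ : ℤ) : cc α β γ = cc α γ β := by
  have key : ∀ (n : ℕ) (α β γ : ℤ), α + β + γ ≤ n → cc α β γ = cc α γ β := by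
    intro n
    induction n with
    | zero =>
      intro α β γ h
      by_cases hneg : α < 0 ∨ β < 0 ∨ γ < 0
      · rw [cc_eq_zero hneg, cc_eq_zero (by omega)]
      · obtain ⟨rfl, rfl, rfl⟩ : α = 0 ∧ β = 0 ∧ γ = 0 := by push_cast at h; omega
        rfl
    | succ n ih =>
      intro α β γ h
      push_cast at h
      by_cases h0 : α = 0 ∧ β = 0 ∧ γ = 0
      · obtain ⟨rfl, rfl, rfl⟩ := h0
        rfl
      · rw [cc_rec h0, cc_rec (α := α) (β := γ) (by tauto), ih (α - 1) β γ (by omega),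
          ih α (β - 1) γ (by omega), ih α β (γ - 1) (by omega),
          ih (α + 1) (β - 1) (γ - 1) (by omega), ih (α + 1) (β - 2) γ (by omega),
          ih (α + 1) β (γ - 2) (by omega)]
        ring
  exact key (α + β + γ).toNat α β γ (by omega)

/-! ### The weighted sums of monomials -/

/-- The coefficient `cc`, restricted to the plane `α + β + γ = t`. -/
def coef (t : ℕ) (v : ℤ × ℤ × ℤ) : ℂ :=
  if v.1 + v.2.1 + v.2.2 = t then ((cc v.1 v.2.1 v.2.2 : ℚ) : ℂ) else 0

/-- The monomial `E ^ α x ^ β y ^ γ`. -/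
def mon (E x y : ℂ) (v : ℤ × ℤ × ℤ) : ℂ := E ^ v.1.toNat * x ^ v.2.1.toNat * y ^ v.2.2.toNat

/-- The image of `mon E x y v` under the derivation of the differential system, twisted by
the logarithmic derivative of `θ₄`. -/
def monStep (E x y : ℂ) (v : ℤ × ℤ × ℤ) : ℂ :=
  v.1 * E ^ (v.1.toNat - 1) * x ^ v.2.1.toNat * y ^ v.2.2.toNat *
    ((E ^ 2 - x ^ 2 - 14 * x * y - y ^ 2) / 12) +
  mon E x y v * (v.2.1 * (E + 5 * y - x) / 6 + v.2.2 * (E + 5 * x - y) / 6 + (E - x - y) / 24)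

/-- The index set `{(α, β, γ) : α, β, γ ≥ 0, α + β + γ = t}` inside `ℤ³`. -/
def indexSet (t : ℕ) : Finset (ℤ × ℤ × ℤ) :=
  (Finset.Nat.antidiagonalTuple 3 t).image fun v => ((v 0 : ℤ), (v 1 : ℤ), (v 2 : ℤ))

lemma coef_eq_zero_of_neg (t : ℕ) {v : ℤ × ℤ × ℤ} (h : v.1 < 0 ∨ v.2.1 < 0 ∨ v.2.2 < 0) :
    coef t v = 0 := by
  rw [coef, cc_eq_zero h]; simp

lemma coef_eq_zero {t : ℕ} {v : ℤ × ℤ × ℤ} (h : v ∉ indexSet t) : coef t v = 0 := by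
  by_cases hneg : v.1 < 0 ∨ v.2.1 < 0 ∨ v.2.2 < 0
  · exact coef_eq_zero_of_neg t hneg
  · rw [coef, if_neg]
    intro hs
    refine h (Finset.mem_image.2 ⟨![v.1.toNat, v.2.1.toNat, v.2.2.toNat], ?_, ?_⟩)
    · rw [Finset.Nat.mem_antidiagonalTuple]
      simp only [Fin.sum_univ_three, Matrix.cons_val]
      omega
    · obtain ⟨a, b, c⟩ := v
      simp only at hneg
      simp only [Matrix.cons_val, Prod.mk.injEq]
      omega

lemma sum_indexSet (t : ℕ) (f : ℤ × ℤ × ℤ → ℂ) :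
    ∑ v ∈ indexSet t, f v = ∑ v ∈ Finset.Nat.antidiagonalTuple 3 t, f (v 0, v 1, v 2) := by
  rw [indexSet, Finset.sum_image]
  intro v _ w _ h
  simp only [Prod.mk.injEq, Nat.cast_inj] at h
  ext i
  fin_cases i
  exacts [h.1, h.2.1, h.2.2]

lemma coef_succ (t : ℕ) (α β γ : ℤ) :
    coef (t + 1) (α, β, γ) =
      (2 * α + 4 * β + 4 * γ - 1) / 24 * coef t (α - 1, β, γ)
      + (20 * γ - 4 * β + 3) / 24 * coef t (α, β - 1, γ)
      + (20 * β - 4 * γ + 3) / 24 * coef t (α, β, γ - 1)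
      - 7 * (α + 1) / 6 * coef t (α + 1, β - 1, γ - 1)
      - (α + 1) / 12 * coef t (α + 1, β - 2, γ)
      - (α + 1) / 12 * coef t (α + 1, β, γ - 2) := by
  simp only [coef]
  by_cases h : α + β + γ = (t + 1 : ℕ)
  · push_cast at h
    rw [if_pos (by push_cast; omega), if_pos (by omega), if_pos (by omega), if_pos (by omega),
      if_pos (by omega), if_pos (by omega), if_pos (by omega), cc_rec (by omega)]
    push_cast
    ring
  · push_cast at h
    rw [if_neg (by push_cast; omega), if_neg (by omega), if_neg (by omega), if_neg (by omega),
      if_neg (by omega), if_neg (by omega), if_neg (by omega)]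
    ring

lemma hasSum_coef_mul (t : ℕ) (f : ℤ × ℤ × ℤ → ℂ) :
    HasSum (fun v => coef t v * f v) (∑ v ∈ indexSet t, coef t v * f v) :=
  hasSum_sum_of_ne_finset_zero fun v hv => by rw [coef_eq_zero hv, zero_mul]

/-- Summing over all of ℤ³ makes an index shift a bijection, which it is not on the finite index
sets. -/
lemma hasSum_coef_mul_shift (t : ℕ) (f : ℤ × ℤ × ℤ → ℂ) (e : ℤ × ℤ × ℤ) :
    HasSum (fun v => coef t (v - e) * f v) (∑ v ∈ indexSet t, coef t v * f (v + e)) := by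
  rw [← (Equiv.addRight e).hasSum_iff]
  simpa [Function.comp_def] using hasSum_coef_mul t fun v => f (v + e)

lemma mon_shift_eq_monStep (E x y : ℂ) {α β γ : ℤ} (hα : 0 ≤ α) (hβ : 0 ≤ β) (hγ : 0 ≤ γ) :
    (2 * (α + 1) + 4 * β + 4 * γ - 1) / 24 * mon E x y (α + 1, β, γ)
      + (20 * γ - 4 * (β + 1) + 3) / 24 * mon E x y (α, β + 1, γ)
      + (20 * β - 4 * (γ + 1) + 3) / 24 * mon E x y (α, β, γ + 1)
      - 7 * α / 6 * mon E x y (α - 1, β + 1, γ + 1)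
      - α / 12 * mon E x y (α - 1, β + 2, γ)
      - α / 12 * mon E x y (α - 1, β, γ + 2) = monStep E x y (α, β, γ) := by
  lift α to ℕ using hα
  lift β to ℕ using hβ
  lift γ to ℕ using hγ
  have h1 (n : ℕ) : ((n : ℤ) + 1).toNat = n + 1 := by omega
  have h2 (n : ℕ) : ((n : ℤ) + 2).toNat = n + 2 := by omega
  have h3 (n : ℕ) : ((n : ℤ) - 1).toNat = n - 1 := by omega
  simp only [mon, monStep, h1, h2, h3, Int.toNat_natCast, Int.cast_natCast]
  -- At α = 0 the truncated exponent α - 1 is harmless because its coefficient is 0.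
  rcases α with _ | α
  · simp only [Nat.cast_zero]; ring
  · simp only [Nat.add_one_sub_one]; push_cast; ring

lemma sum_coef_succ (t : ℕ) (E x y : ℂ) :
    ∑ v ∈ indexSet (t + 1), coef (t + 1) v * mon E x y v =
      ∑ v ∈ indexSet t, coef t v * monStep E x y v := by
  have h1 := hasSum_coef_mul_shift t
    (fun v => (2 * v.1 + 4 * v.2.1 + 4 * v.2.2 - 1) / 24 * mon E x y v) (1, 0, 0)
  have h2 := hasSum_coef_mul_shift t
    (fun v => (20 * v.2.2 - 4 * v.2.1 + 3) / 24 * mon E x y v) (0, 1, 0)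
  have h3 := hasSum_coef_mul_shift t
    (fun v => (20 * v.2.1 - 4 * v.2.2 + 3) / 24 * mon E x y v) (0, 0, 1)
  have h4 := hasSum_coef_mul_shift t (fun v => 7 * (v.1 + 1) / 6 * mon E x y v) (-1, 1, 1)
  have h5 := hasSum_coef_mul_shift t (fun v => (v.1 + 1) / 12 * mon E x y v) (-1, 2, 0)
  have h6 := hasSum_coef_mul_shift t (fun v => (v.1 + 1) / 12 * mon E x y v) (-1, 0, 2)
  have h := ((((h1.add h2).add h3).sub h4).sub h5).sub h6
  simp only [← Finset.sum_add_distrib, ← Finset.sum_sub_distrib] at h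
  refine ((hasSum_coef_mul (t + 1) (mon E x y)).unique (h.congr_fun fun v => ?_)).trans
    (Finset.sum_congr rfl fun v _ => ?_)
  · obtain ⟨α, β, γ⟩ := v
    simp only [Prod.mk_sub_mk, sub_zero, sub_neg_eq_add]
    rw [coef_succ]
    ring
  · obtain ⟨α, β, γ⟩ := v
    by_cases hneg : α < 0 ∨ β < 0 ∨ γ < 0
    · simp [coef_eq_zero_of_neg t (v := (α, β, γ)) hneg]
    · simp only [not_or, not_lt] at hneg
      rw [← mon_shift_eq_monStep E x y hneg.1 hneg.2.1 hneg.2.2]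
      simp only [Prod.mk_add_mk, add_zero, ← sub_eq_add_neg]
      push_cast
      ring

/-! ### Iterated derivatives of `θ₄` -/

/-- `mon` evaluated at `E₂`, `θ₂⁴`, `θ₃⁴`. -/
def monTheta (v : ℤ × ℤ × ℤ) (q : ℂ) : ℂ := mon (thetaE q) (q * psi q ^ 4) (theta3 q ^ 4) v

lemma differentiableAt_monTheta (v : ℤ × ℤ × ℤ) {q : ℂ} (hq : ‖q‖ < 1) :
    DifferentiableAt ℂ (monTheta v) q :=
  (((differentiableAt_thetaE hq).fun_pow _).fun_mul
    ((differentiableAt_theta2_pow hq).fun_pow _)).fun_mul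
    ((differentiableAt_theta3_pow hq).fun_pow _)

lemma natCast_mul_pow_sub_one_mul (n : ℕ) (x : ℂ) : n * x ^ (n - 1) * x = n * x ^ n := by
  rcases n with _ | n
  · simp
  · rw [Nat.add_one_sub_one]; ring

lemma D_theta4_mul_monTheta {v : ℤ × ℤ × ℤ} (h : 0 ≤ v.1 ∧ 0 ≤ v.2.1 ∧ 0 ≤ v.2.2) {q : ℂ}
    (hq : ‖q‖ < 1) : D (fun p => theta4 p * monTheta v p) q =
      theta4 q * monStep (thetaE q) (q * psi q ^ 4) (theta3 q ^ 4) v := by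
  obtain ⟨α, β, γ⟩ := v
  obtain ⟨hα, hβ, hγ⟩ := h
  simp only at hα hβ hγ
  lift α to ℕ using hα
  lift β to ℕ using hβ
  lift γ to ℕ using hγ
  have dE := differentiableAt_thetaE hq
  have dx := differentiableAt_theta2_pow hq
  have dy := differentiableAt_theta3_pow hq
  have hmon : D (monTheta (α, β, γ)) q =
      D (fun p => thetaE p ^ α * (p * psi p ^ 4) ^ β * (theta3 p ^ 4) ^ γ) q := rfl
  rw [D_mul (differentiableAt_theta4 hq) (differentiableAt_monTheta _ hq), D_theta4 hq, hmon,
    D_mul ((dE.fun_pow α).fun_mul (dx.fun_pow β)) (dy.fun_pow γ),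
    D_mul (dE.fun_pow α) (dx.fun_pow β), D_pow dE, D_pow dx, D_pow dy, D_thetaE hq,
    D_theta2_pow hq, D_theta3_pow hq]
  have hx := natCast_mul_pow_sub_one_mul β (q * psi q ^ 4)
  have hy := natCast_mul_pow_sub_one_mul γ (theta3 q ^ 4)
  simp only [monTheta, monStep, mon, Int.toNat_natCast, Int.cast_natCast]
  generalize thetaE q = E at *
  generalize q * psi q ^ 4 = x at *
  generalize theta3 q ^ 4 = y at *
  linear_combination theta4 q * E ^ α * y ^ γ * (E + 5 * y - x) / 6 * hx +
    theta4 q * E ^ α * x ^ β * (E + 5 * x - y) / 6 * hy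

lemma D_sum {ι : Type*} (s : Finset ι) (c : ι → ℂ) (f : ι → ℂ → ℂ) {q : ℂ}
    (hf : ∀ i, DifferentiableAt ℂ (f i) q) :
    D (fun p => ∑ i ∈ s, c i * f i p) q = ∑ i ∈ s, c i * D (f i) q := by
  simp only [D]
  rw [deriv_fun_sum fun i _ => (hf i).const_mul (c i), Finset.mul_sum]
  exact Finset.sum_congr rfl fun i _ => by rw [deriv_const_mul_field]; ring

lemma nonneg_of_mem_indexSet {t : ℕ} {v : ℤ × ℤ × ℤ} (h : v ∈ indexSet t) :
    0 ≤ v.1 ∧ 0 ≤ v.2.1 ∧ 0 ≤ v.2.2 := by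
  obtain ⟨w, -, rfl⟩ := Finset.mem_image.1 h
  exact ⟨Int.natCast_nonneg _, Int.natCast_nonneg _, Int.natCast_nonneg _⟩

lemma iterate_D_theta4 (t : ℕ) {q : ℂ} (hq : ‖q‖ < 1) :
    D^[t] theta4 q = ∑ v ∈ indexSet t, coef t v * (theta4 q * monTheta v q) := by
  induction t generalizing q with
  | zero =>
    rw [sum_indexSet]
    simp [coef, cc_zero, monTheta, mon, Finset.Nat.antidiagonalTuple_zero_right]
  | succ t ih =>
    -- Differentiation needs the induction hypothesis on the whole disc, hence the generalization
    -- over q.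
    rw [Function.iterate_succ_apply', D_congr (fun p hp => ih hp) hq,
      D_sum _ _ _ fun v => (differentiableAt_theta4 hq).fun_mul (differentiableAt_monTheta v hq)]
    have h := sum_coef_succ t (thetaE q) (q * psi q ^ 4) (theta3 q ^ 4)
    calc _ = ∑ v ∈ indexSet t, coef t v *
          (theta4 q * monStep (thetaE q) (q * psi q ^ 4) (theta3 q ^ 4) v) :=
        Finset.sum_congr rfl fun v hv => by
          rw [D_theta4_mul_monTheta (nonneg_of_mem_indexSet hv) hq]
      _ = theta4 q * ∑ v ∈ indexSet t, coef t v *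
          monStep (thetaE q) (q * psi q ^ 4) (theta3 q ^ 4) v := by
        rw [Finset.mul_sum]; exact Finset.sum_congr rfl fun v _ => by ring
      _ = _ := by
        rw [← h, Finset.mul_sum]
        exact Finset.sum_congr rfl fun v _ => by rw [monTheta]; ring

lemma sum_antidiagonalTuple_swap (t : ℕ) (f : ℕ → ℕ → ℕ → ℂ) :
    ∑ v ∈ Finset.Nat.antidiagonalTuple 3 t, f (v 0) (v 1) (v 2) =
      ∑ v ∈ Finset.Nat.antidiagonalTuple 3 t, f (v 0) (v 2) (v 1) := by
  refine Finset.sum_nbij' (fun v => ![v 0, v 2, v 1]) (fun v => ![v 0, v 2, v 1]) ?_ ?_ ?_ ?_ ?_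
  · intro v hv
    rw [Finset.Nat.mem_antidiagonalTuple, Fin.sum_univ_three] at *
    simp only [Matrix.cons_val]; omega
  · intro v hv
    rw [Finset.Nat.mem_antidiagonalTuple, Fin.sum_univ_three] at *
    simp only [Matrix.cons_val]; omega
  · intro v _; ext i; fin_cases i <;> rfl
  · intro v _; ext i; fin_cases i <;> rfl
  · intro v _; rfl

end QTheta

end


theorem theorem1p3 (t : ℕ) (ht : 1 ≤ t) (q : ℂ) (hq : ‖q‖ < 1) :
    QTheta.theta4 q ≠ 0 ∧
    (QTheta.D^[t] QTheta.theta4) q / QTheta.theta4 q =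
      (1 / 2 : ℂ) * ∑ v ∈ Finset.Nat.antidiagonalTuple 3 t,
        ((QTheta.cc (v 0) (v 1) (v 2) : ℚ) : ℂ) *
          QTheta.eisenstein 1 q ^ (v 0) * QTheta.Theta (v 1) (v 2) q := by
  open QTheta in
  have h4 := theta4_ne_zero hq
  refine ⟨h4, ?_⟩
  set E := eisenstein 1 q with hE
  set x := theta2 q ^ 4 with hx
  set y := theta3 q ^ 4 with hy
  have hD : D^[t] theta4 q / theta4 q = ∑ v ∈ Finset.Nat.antidiagonalTuple 3 t,
      ((cc (v 0) (v 1) (v 2) : ℚ) : ℂ) * E ^ v 0 * (x ^ v 1 * y ^ v 2) := by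
    rw [iterate_D_theta4 t hq, sum_indexSet, Finset.sum_div]
    refine Finset.sum_congr rfl fun v hv => ?_
    rw [Finset.Nat.mem_antidiagonalTuple, Fin.sum_univ_three] at hv
    rw [coef, if_pos (by simpa using mod_cast hv), monTheta, mon, ← eisenstein_one_eq_thetaE hq,
      ← theta2_pow_four]
    simp only [Int.toNat_natCast]
    field_simp
    rfl
  have hswap := sum_antidiagonalTuple_swap t fun a b c =>
    ((cc a b c : ℚ) : ℂ) * E ^ a * (x ^ b * y ^ c)
  have hTheta (r s : ℕ) : Theta r s q = x ^ r * y ^ s + x ^ s * y ^ r := by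
    simp only [Theta, pow_mul, ← hx, ← hy]
  simp only [hTheta, mul_add, Finset.sum_add_distrib]
  rw [← hD]
  -- By symmetry of `cc`, the mirrored half of the Θ sum equals the first, which accounts for the
  -- factor 1/2.
  have h2 : ∑ v ∈ Finset.Nat.antidiagonalTuple 3 t,
      ((cc (v 0) (v 1) (v 2) : ℚ) : ℂ) * E ^ v 0 * (x ^ v 2 * y ^ v 1) =
      D^[t] theta4 q / theta4 q := by
    rw [hD, hswap]
    exact Finset.sum_congr rfl fun v _ => by rw [cc_symm]
  rw [h2]
  ring
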